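/- Let $\mathcal{G}$ be a finite groupoid with set of objects $\mathcal{G}_0$ (identified with the identity morphisms), domain map $d$ and range map $r$, let $K$ be a commutative ring and $R$ an associative unital $K$-algebra with center $C(R)$. Let $\beta=(\{E_g\}_{g\in\mathcal{G}},\{\beta_g\}_{g\in\mathcal{G}})$ be a unital action of $\mathcal{G}$ on $R$: each $E_g=E_{r(g)}$ is a two-sided ideal of $R$ that has an identity element $1_g$, each $\beta_g:E_{g^{-1}}\to E_g$ is an isomorphism of $K$-algebras, $\beta_e=\mathrm{Id}_{E_e}$ for $e\in\mathcal{G}_0$, and $\beta_g(\beta_h(x))=\beta_{gh}(x)$ whenever $d(g)=r(h)$ and $x\in E_{h^{-1}}$. Assume that $R=\bigoplus_{e\in\mathcal{G}_0}E_e$. A subgroupoid of $\mathcal{G}$ is a non-empty subset closed under composition and inverses; it is wide if it contains all of $\mathcal{G}_0$. For a wide subgroupoid $\mathcal{H}$ put $R^{\beta_{\mathcal{H}}}=\{x\in R : \beta_h(x1_{h^{-1}})=x1_h \text{ for all } h\in\mathcal{H}\}$, let $R^{\beta}=R^{\beta_{\mathcal{G}}}$ and $C(R)^{\beta}=C(R)\cap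 R^{\beta}$. For $g\in\mathcal{G}$ let $J_g=\{x\in E_g : x\,\beta_g(y1_{g^{-1}})=yx\text{ for all }y\in R\}$. For a subgroupoid $\mathcal{H}$ let $S_{\mathcal{H}}=\{g\in\mathcal{H} : J_g\neq\{0\}\}$, and let $\overline{\mathcal{H}}$ be the set of all subgroupoids $\mathcal{L}$ of $\mathcal{G}$ with $S_{\mathcal{L}}=S_{\mathcal{H}}$. Assume that 1. $R$ is a $\beta$-Galois extension of $R^{\beta}$, that is, there are $x_1,\dots,x_m,y_1,\dots,y_m\in R$ such that $\sum_{i=1}^m x_i\beta_g(y_i1_{g^{-1}})=\sum_{e\in\mathcal{G}_0}\delta_{e,g}1_e$ for all $g\in\mathcal{G}$; 2. $R^{\beta}$ is separable over $C(R)^{\beta}$, that is, there is $z=\sum_j a_j\otimes b_j\in R^{\beta}\otimes_{C(R)^{\beta}}R^{\beta}$ with $\sum_j a_jb_j=1$ and $az=za$ for all $a\in R^{\beta}$; 3. $\overline{\mathcal{H}}=\{\mathcal{H}\}$ for every wide subgroupoid $\mathcal{H}$ of $\mathcal{G}$. Then the Galois map $\theta:\mathcal{H}\mapsto R^{\beta_{\mathcal{H}}}$,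 defined on the set of wide subgroupoids of $\mathcal{G}$, is injective. -/

import Mathlib

open CategoryTheory
open scoped TensorProduct

universe u v w z

noncomputable section

/-- `A` is a separable algebra over the commutative ring `S`: there is `t = ∑ xᵢ ⊗ yᵢ` in
`A ⊗[S] A` with `∑ xᵢ yᵢ = 1` and `a t = t a` for all `a`, where `a t = ∑ a xᵢ ⊗ yᵢ` is the product
`(a ⊗ 1) t`, and `t a = ∑ xᵢ ⊗ yᵢ a` is the product `t (1 ⊗ a)` in the algebra `A ⊗[S] A`. -/
def IsSeparableExtension (S : Type*) (A : Type*) [CommRing S] [Ring A] [Algebra S A] : Prop :=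
  ∃ t : A ⊗[S] A, LinearMap.mul' S A t = 1 ∧
    ∀ a : A, (a ⊗ₜ[S] (1 : A)) * t = t * ((1 : A) ⊗ₜ[S] a)

/-- A unital action of the groupoid with set of objects `X` on the `K`-algebra `R`.
An arrow `g : a ⟶ b` has domain `a` and range `b`; the product "first `h`, then `g`" is `h ≫ g`.
The ideal attached to an arrow depends only on its range, so the ideals are indexed by objects,
and an arrow `g : a ⟶ b` gives an isomorphism from `E a` to `E b`. -/
structure UnitalGroupoidAction (X : Type u) [Groupoid.{v} X] (K : Type w) [CommRing K]
    (R : Type z) [Ring R] [Algebra K R] where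
  /-- the ideals -/
  E : X → Ideal R
  /-- they are two-sided -/
  mul_mem_right : ∀ (a : X) (x r : R), x ∈ E a → x * r ∈ E a
  /-- the `K`-linear isomorphisms -/
  β : ∀ {a b : X}, (a ⟶ b) → (E a ≃ₗ[K] E b)
  /-- they are multiplicative -/
  map_mul : ∀ {a b : X} (g : a ⟶ b) (x y : E a),
    (β g ⟨(x : R) * (y : R), (E a).mul_mem_left (x : R) y.2⟩ : R) = (β g x : R) * (β g y : R)
  /-- identities act as identities -/
  β_id : ∀ (a : X) (x : E a), β (𝟙 a) x = x
  /-- compatibility with composition -/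
  β_comp : ∀ {a b c : X} (h : a ⟶ b) (g : b ⟶ c) (x : E a), β g (β h x) = β (h ≫ g) x
  /-- the identity element of the ring `E a` -/
  one : X → R
  one_mem : ∀ a, one a ∈ E a
  one_mul : ∀ (a : X) (x : R), x ∈ E a → one a * x = x
  mul_one : ∀ (a : X) (x : R), x ∈ E a → x * one a = x

namespace UnitalGroupoidAction

variable {X : Type u} [Groupoid.{v} X] {K : Type w} [CommRing K] {R : Type z} [Ring R]
  [Algebra K R] (B : UnitalGroupoidAction X K R)

/-- `B.app g r` is `β_g (r 1_{d(g)})`, as an element of `R`. -/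
def app {a b : X} (g : a ⟶ b) (r : R) : R :=
  (B.β g ⟨r * B.one a, (B.E a).mul_mem_left r (B.one_mem a)⟩ : R)

theorem app_mem {a b : X} (g : a ⟶ b) (r : R) : B.app g r ∈ B.E b := (B.β g _).2

theorem one_comm (a : X) (r : R) : B.one a * r = r * B.one a := by
  rw [← B.mul_one a (B.one a * r) (B.mul_mem_right a _ r (B.one_mem a)), mul_assoc,
    B.one_mul a (r * B.one a) ((B.E a).mul_mem_left r (B.one_mem a))]

theorem app_add {a b : X} (g : a ⟶ b) (r s : R) : B.app g (r + s) = B.app g r + B.app g s := by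
  unfold app
  rw [← Submodule.coe_add, ← map_add]
  congr 2
  exact Subtype.ext (add_mul r s (B.one a))

theorem app_smul {a b : X} (g : a ⟶ b) (k : K) (r : R) : B.app g (k • r) = k • B.app g r := by
  unfold app
  rw [← Submodule.coe_smul_of_tower, ← map_smul]
  congr 2
  exact Subtype.ext (smul_mul_assoc k r (B.one a))

theorem app_mul {a b : X} (g : a ⟶ b) (r s : R) : B.app g (r * s) = B.app g r * B.app g s := by
  unfold app
  rw [← B.map_mul]
  congr 2
  refine Subtype.ext ?_
  change r * s * B.one a = r * B.one a * (s * B.one a)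
  rw [mul_assoc r (B.one a), B.one_mul a _ ((B.E a).mul_mem_left s (B.one_mem a)), mul_assoc]

theorem app_one {a b : X} (g : a ⟶ b) : B.app g 1 = B.one b := by
  obtain ⟨y, hy⟩ := (B.β g).surjective ⟨B.one b, B.one_mem b⟩
  have h1 : B.app g 1 * (B.β g y : R) = (B.β g y : R) := by
    unfold app
    rw [← B.map_mul]
    congr 2
    refine Subtype.ext ?_
    change 1 * B.one a * (y : R) = y
    rw [_root_.one_mul, B.one_mul a _ y.2]
  rw [hy] at h1
  exact (B.mul_one b _ (B.app_mem g 1)).symm.trans h1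

/-- For a wide subgroupoid `H` this is the subalgebra `R^{β_H}` of invariants of the restricted
action: `β_g (r 1_{d(g)}) = r 1_{r(g)}` for all `g` in `H`. -/
def invariants (H : Subgroupoid X) : Subalgebra K R where
  carrier := {r | ∀ ⦃a b : X⦄ (g : a ⟶ b), g ∈ H.arrows a b → B.app g r = r * B.one b}
  mul_mem' {r s} hr hs a b g hg := by
    rw [B.app_mul, hr g hg, hs g hg, mul_assoc r (B.one b),
      B.one_mul b _ ((B.E b).mul_mem_left s (B.one_mem b)), mul_assoc]
  add_mem' {r s} hr hs a b g hg := by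
    rw [B.app_add, hr g hg, hs g hg, add_mul]
  algebraMap_mem' k a b g _ := by
    rw [Algebra.algebraMap_eq_smul_one, B.app_smul, B.app_one, smul_mul_assoc, _root_.one_mul]

/-- `R^β`. -/
abbrev invariantRing : Subalgebra K R := B.invariants ⊤

/-- `C(R)^β`: the elements of the center `C(R)` that are invariant under `β`. -/
abbrev centerInvariants : Subalgebra K (Subalgebra.center K R) :=
  B.invariantRing.comap (Subalgebra.center K R).val

/-- The inclusion of `C(R)^β` into `R^β` makes `R^β` a `C(R)^β`-algebra. -/
instance algebraInvariants : Algebra B.centerInvariants B.invariantRing :=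
  RingHom.toAlgebra'
    { toFun := fun c => ⟨((c : Subalgebra.center K R) : R), c.2⟩
      map_one' := rfl
      map_mul' := fun _ _ => rfl
      map_zero' := rfl
      map_add' := fun _ _ => rfl }
    (fun c r => Subtype.ext (Subalgebra.mem_center_iff.1 (c : Subalgebra.center K R).2 (r : R)).symm)

open Classical in
/-- `R` is the (internal) direct sum of the ideals `E e`, over all objects `e`. -/
def IsDirectSum : Prop := DirectSum.IsInternal B.E

open Classical in
/-- `R` is a `β`-Galois extension of `R^β` (for a finite groupoid): there are `xᵢ, yᵢ` with
`∑ᵢ xᵢ β_g (yᵢ 1_{d(g)}) = ∑ₑ δ_{e,g} 1ₑ` for all arrows `g`, where `δ_{e,g}` compares the identity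
arrow of the object `e` with the arrow `g`. -/
def IsGaloisExtension [Fintype X] : Prop :=
  ∃ (m : ℕ) (x y : Fin m → R), ∀ ⦃a b : X⦄ (g : a ⟶ b),
    ∑ i, x i * B.app g (y i) = ∑ e : X, if Arrow.mk (𝟙 e) = Arrow.mk g then B.one e else 0

/-- `J_g = {r ∈ E_g | r β_g (x 1_{d(g)}) = x r for all x ∈ R}`, a `C(R)`-submodule of `R`. -/
def J {a b : X} (g : a ⟶ b) : Submodule (Subring.center R) R where
  carrier := {r | r ∈ B.E b ∧ ∀ x : R, r * B.app g x = x * r}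
  add_mem' {r s} hr hs := ⟨add_mem hr.1 hs.1, fun x => by rw [add_mul, hr.2, hs.2, mul_add]⟩
  zero_mem' := ⟨zero_mem _, fun x => by rw [zero_mul, mul_zero]⟩
  smul_mem' c r hr := by
    refine ⟨(B.E b).mul_mem_left (c : R) hr.1, fun x => ?_⟩
    change (c : R) * r * B.app g x = x * ((c : R) * r)
    rw [mul_assoc, hr.2, ← mul_assoc, ← mul_assoc, Subring.mem_center_iff.1 c.2 x]

/-- `S_H = {g ∈ H | J_g ≠ 0}`. -/
def S (H : Subgroupoid X) (a b : X) : Set (a ⟶ b) := {g | g ∈ H.arrows a b ∧ B.J g ≠ ⊥}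

/-- The class of `H`: all (non-empty) subgroupoids `L` with `S_L = S_H`. -/
def bar (H : Subgroupoid X) : Set (Subgroupoid X) :=
  {L | (∃ (a b : X) (g : a ⟶ b), g ∈ L.arrows a b) ∧ B.S L = B.S H}

/-- The Galois map `H ↦ R^{β_H}` on the set of (non-empty) wide subgroupoids. -/
def galoisMap
    (H : {H : Subgroupoid X // (∃ (a b : X) (g : a ⟶ b), g ∈ H.arrows a b) ∧ H.IsWide}) :
    Subalgebra K R :=
  B.invariants H.1

end UnitalGroupoidAction

end

namespace UnitalGroupoidAction

variable {X : Type u} [Groupoid.{v} X] {K : Type w} [CommRing K] {R : Type z} [Ring R]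
  [Algebra K R] (B : UnitalGroupoidAction X K R)

/-! The ring `R^{β_H}` determines `S_H`: an arrow `g` with `J_g ≠ 0` lies in `H` exactly when `J_g`
centralizes `R^{β_H}`. That arrows of `H` have this property is a direct computation
(`commute_of_mem_J`). The converse (`mem_of_commute`) uses Galois coordinates and the trace `t_H`:
expanding a nonzero `c ∈ J_g` in the coordinates and moving traces past `c` would give `c = 0` if
`g` were outside `H`. Equal invariant rings thus give equal sets `S`, and a class `B.bar H` with a
single element leaves only one subgroupoid. -/

theorem app_zero {a b : X} (g : a ⟶ b) : B.app g 0 = 0 := by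
  simpa using B.app_add g 0 0

theorem app_sum {ι : Type*} (s : Finset ι) (f : ι → R) {a b : X} (g : a ⟶ b) :
    B.app g (∑ i ∈ s, f i) = ∑ i ∈ s, B.app g (f i) :=
  map_sum (AddMonoidHom.mk' (B.app g) (B.app_add g)) f s

theorem app_eq_of_mem {a b : X} (g : a ⟶ b) (r : R) (hr : r ∈ B.E a) :
    B.app g r = B.β g ⟨r, hr⟩ := by
  unfold app
  congr 2
  exact Subtype.ext (B.mul_one a r hr)

theorem app_app {a b c : X} (h : a ⟶ b) (g : b ⟶ c) (r : R) :
    B.app g (B.app h r) = B.app (h ≫ g) r := by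
  rw [B.app_eq_of_mem g _ (B.app_mem h r)]
  exact congrArg Subtype.val (B.β_comp h g _)

theorem app_id (a : X) (r : R) : B.app (𝟙 a) r = r * B.one a :=
  congrArg Subtype.val (B.β_id a _)

variable {B}

theorem IsDirectSum.mul_eq_zero (hsum : B.IsDirectSum) {a b : X} (hab : a ≠ b) {r s : R}
    (hr : r ∈ B.E a) (hs : s ∈ B.E b) : r * s = 0 := by
  classical
  have hd : Disjoint (B.E a) (B.E b) := by
    have := DirectSum.IsInternal.submodule_iSupIndep (A := B.E) (by unfold IsDirectSum at hsum; convert hsum)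
    exact this.pairwiseDisjoint hab
  exact Submodule.disjoint_def.1 hd _ (B.mul_mem_right a r s hr) ((B.E b).mul_mem_left r hs)

theorem IsDirectSum.sum_one [Fintype X] (hsum : B.IsDirectSum) : ∑ e, B.one e = 1 := by
  classical
  have htop : ⨆ e, B.E e = ⊤ :=
    DirectSum.IsInternal.submodule_iSup_eq_top (A := B.E) (by unfold IsDirectSum at hsum; convert hsum)
  have key : ∀ r ∈ ⨆ e, B.E e, (∑ e, B.one e) * r = r := by
    intro r hr
    induction hr using Submodule.iSup_induction' with
    | mem a r hr =>
      rw [Finset.sum_mul, Finset.sum_eq_single a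
        (fun e _ he => hsum.mul_eq_zero he (B.one_mem e) hr) (by simp), B.one_mul a r hr]
    | zero => rw [mul_zero]
    | add r s _ _ hr hs => rw [mul_add, hr, hs]
  simpa using key 1 (by rw [htop]; trivial)

/-- `B.app g` sees only the component `r 1_b`, which vanishes for `r` in another summand. -/
theorem IsDirectSum.app_eq_zero (hsum : B.IsDirectSum) {a b c : X} (hab : a ≠ b) (g : b ⟶ c)
    {r : R} (hr : r ∈ B.E a) : B.app g r = 0 := by
  have h : r * B.one b = 0 := hsum.mul_eq_zero hab hr (B.one_mem b)
  have h1 : B.app g (r * B.one b) = B.app g r := by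
    rw [B.app_mul, B.app_eq_of_mem g _ (B.one_mem b)]
    conv_rhs => rw [← _root_.mul_one r, B.app_mul]
    congr 1
    unfold app
    congr 2
    exact Subtype.ext (_root_.one_mul _).symm
  rw [← h1, h, B.app_zero]

/-! ### The trace of a subgroupoid -/

section Trace

variable (B) [Fintype X] [∀ a b : X, Finite (a ⟶ b)]

open Classical in
/-- The trace `∑ β_h (r 1_{d(h)})` over the arrows `h` of the subgroupoid `H`. -/
noncomputable def trace (H : Subgroupoid X) (r : R) : R :=
  letI (a b : X) : Fintype (H.arrows a b) := Fintype.ofFinite _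
  ∑ b, ∑ a, ∑ h : H.arrows a b, B.app (h : a ⟶ b) r

variable {B}

/-- The summands with range `b` form the component of the trace in `E b`. Composition with `g : a ⟶
b` in `H` is a bijection from the arrows of `H` ending at `a` to those ending at `b`, so `β_g`
carries one component to the other. -/
theorem IsDirectSum.trace_mem_invariants (hsum : B.IsDirectSum) (H : Subgroupoid X) (r : R) :
    B.trace H r ∈ B.invariants H := by
  classical
  let (a b : X) : Fintype (H.arrows a b) := Fintype.ofFinite _
  have hmem (b : X) : ∑ a, ∑ h : H.arrows a b, B.app (h : a ⟶ b) r ∈ B.E b :=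
    sum_mem fun a _ => sum_mem fun h _ => B.app_mem _ _
  intro a b g hg
  change B.app g (∑ b, ∑ a, ∑ h : H.arrows a b, B.app (h : a ⟶ b) r) =
    (∑ b, ∑ a, ∑ h : H.arrows a b, B.app (h : a ⟶ b) r) * B.one b
  rw [B.app_sum, Finset.sum_eq_single a (fun c _ hc => hsum.app_eq_zero hc g (hmem c)) (by simp),
    Finset.sum_mul, Finset.sum_eq_single b
      (fun c _ hc => hsum.mul_eq_zero hc (hmem c) (B.one_mem b)) (by simp),
    B.mul_one b _ (hmem b), B.app_sum]
  refine Finset.sum_congr rfl fun c _ => ?_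
  rw [B.app_sum]
  refine Fintype.sum_equiv
    { toFun := fun h => ⟨h.1 ≫ g, H.mul h.2 hg⟩
      invFun := fun h => ⟨h.1 ≫ Groupoid.inv g, H.mul h.2 (H.inv hg)⟩
      left_inv := fun h => Subtype.ext (by simp)
      right_inv := fun h => Subtype.ext (by simp) } _ _ fun h => ?_
  exact B.app_app _ _ _

end Trace

/-! ### Galois coordinates and centralizers -/

section Galois

variable [Fintype X]

variable (B) in
open Classical in
/-- The families `x`, `y` are Galois coordinates of `R` over `R^β`. -/
def IsGaloisCoordinates {m : ℕ} (x y : Fin m → R) : Prop :=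
  ∀ ⦃a b : X⦄ (g : a ⟶ b),
    ∑ i, x i * B.app g (y i) = ∑ e : X, if Arrow.mk (𝟙 e) = Arrow.mk g then B.one e else 0

namespace IsGaloisCoordinates

variable {m : ℕ} {x y : Fin m → R}

theorem sum_id (hxy : B.IsGaloisCoordinates x y) (a : X) :
    ∑ i, x i * B.app (𝟙 a) (y i) = B.one a := by
  classical
  rw [hxy, Finset.sum_eq_single a]
  · exact if_pos rfl
  · exact fun e _ he => if_neg fun h => he (congrArg Comma.left h)
  · simp

theorem sum_of_notMem (hxy : B.IsGaloisCoordinates x y) {H : Subgroupoid X} (hH : H.IsWide)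
    {a b : X} {g : a ⟶ b} (hg : g ∉ H.arrows a b) : ∑ i, x i * B.app g (y i) = 0 := by
  classical
  rw [hxy]
  refine Finset.sum_eq_zero fun e _ => if_neg fun h => hg ?_
  obtain rfl : e = a := congrArg Comma.left h
  obtain rfl : e = b := congrArg Comma.right h
  rw [← Arrow.mk_injective _ _ h]
  exact hH.wide e

theorem sum_of_ne (hxy : B.IsGaloisCoordinates x y) {a b : X} {g : a ⟶ b} (hab : a ≠ b) :
    ∑ i, x i * B.app g (y i) = 0 := by
  classical
  rw [hxy]
  exact Finset.sum_eq_zero fun e _ => if_neg fun h => hab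
    ((congrArg Comma.left h).symm.trans (congrArg Comma.right h))

theorem sum_of_ne_id (hxy : B.IsGaloisCoordinates x y) {a : X} {g : a ⟶ a} (hg : g ≠ 𝟙 a) :
    ∑ i, x i * B.app g (y i) = 0 := by
  classical
  rw [hxy]
  refine Finset.sum_eq_zero fun e _ => if_neg fun h => hg ?_
  obtain rfl : e = a := congrArg Comma.left h
  exact (Arrow.mk_injective _ _ h).symm

theorem sum_app_mul_app (hxy : B.IsGaloisCoordinates x y) (hsum : B.IsDirectSum)
    {H : Subgroupoid X} (hH : H.IsWide) {a b c d : X} {h : c ⟶ d} {g : a ⟶ b}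
    (hh : h ∈ H.arrows c d) (hg : g ∉ H.arrows a b) :
    ∑ i, B.app h (x i) * B.app g (y i) = 0 := by
  by_cases hd : d = b
  · subst hd
    -- Pulling `β_h` out of the sum leaves the Galois sum at `h⁻¹g`, an arrow outside `H`.
    have hk : g ≫ Groupoid.inv h ∉ H.arrows a c := fun hk => hg (by simpa using H.mul hk hh)
    have := congrArg (B.app h) (hxy.sum_of_notMem hH hk)
    simpa [B.app_sum, B.app_mul, B.app_app, B.app_zero] using this
  · exact Finset.sum_eq_zero fun i _ => hsum.mul_eq_zero hd (B.app_mem _ _) (B.app_mem _ _)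

variable [∀ a b : X, Finite (a ⟶ b)]

/-- After exchanging sums, the coefficient of `β_h (r 1_{d(h)})` is the Galois sum at `h`, so only
the identities survive; all of them are in the wide `H`, and their terms add up to `r`. -/
theorem sum_mul_trace (hxy : B.IsGaloisCoordinates x y) (hsum : B.IsDirectSum)
    {H : Subgroupoid X} (hH : H.IsWide) (r : R) :
    ∑ i, x i * B.trace H (y i * r) = r := by
  classical
  let (a b : X) : Fintype (H.arrows a b) := Fintype.ofFinite _
  have hswap : ∑ i, x i * B.trace H (y i * r) =
      ∑ b, ∑ a, ∑ h : H.arrows a b, (∑ i, x i * B.app (h : a ⟶ b) (y i)) * B.app h.1 r := by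
    simp only [trace, Finset.mul_sum, Finset.sum_mul, B.app_mul, mul_assoc]
    rw [Finset.sum_comm]
    refine Finset.sum_congr rfl fun b _ => ?_
    rw [Finset.sum_comm]
    exact Finset.sum_congr rfl fun a _ => Finset.sum_comm
  rw [hswap]
  conv_rhs => rw [← _root_.mul_one r, ← hsum.sum_one, Finset.mul_sum]
  refine Finset.sum_congr rfl fun b _ => ?_
  rw [Finset.sum_eq_single b
      (fun a _ ha => Finset.sum_eq_zero fun h _ => by rw [hxy.sum_of_ne ha, zero_mul]) (by simp),
    Finset.sum_eq_single ⟨𝟙 b, hH.wide b⟩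
      (fun h _ hh => by rw [hxy.sum_of_ne_id fun e => hh (Subtype.ext e), zero_mul]) (by simp),
    hxy.sum_id, B.app_id]
  exact B.one_mul b _ ((B.E b).mul_mem_left r (B.one_mem b))

/-- `∑ᵢ t_H (r xᵢ) β_g (yᵢ 1_{d(g)}) = 0` if `g` is not in the wide subgroupoid `H`. -/
theorem sum_trace_mul_app (hxy : B.IsGaloisCoordinates x y) (hsum : B.IsDirectSum)
    {H : Subgroupoid X} (hH : H.IsWide) {a b : X} {g : a ⟶ b} (hg : g ∉ H.arrows a b) (r : R) :
    ∑ i, B.trace H (r * x i) * B.app g (y i) = 0 := by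
  classical
  let (a b : X) : Fintype (H.arrows a b) := Fintype.ofFinite _
  simp only [trace, Finset.sum_mul, B.app_mul, mul_assoc]
  rw [Finset.sum_comm]
  refine Finset.sum_eq_zero fun d _ => ?_
  rw [Finset.sum_comm]
  refine Finset.sum_eq_zero fun c _ => ?_
  rw [Finset.sum_comm]
  refine Finset.sum_eq_zero fun h _ => ?_
  rw [← Finset.mul_sum, hxy.sum_app_mul_app hsum hH h.2 hg, mul_zero]

/-- An arrow `g` lies in the wide subgroupoid `H` if some nonzero element of `J_g` centralizes
`R^{β_H}`. -/
theorem mem_of_commute (hxy : B.IsGaloisCoordinates x y) (hsum : B.IsDirectSum)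
    {H : Subgroupoid X} (hH : H.IsWide) {a b : X} {g : a ⟶ b} {c : R} (hc : c ∈ B.J g)
    (hc0 : c ≠ 0) (hcomm : ∀ s ∈ B.invariants H, c * s = s * c) : g ∈ H.arrows a b := by
  by_contra hg
  apply hc0
  have hright (r : R) : r * c = ∑ j, x j * c * B.trace H (y j * r) := by
    conv_lhs => rw [← hxy.sum_mul_trace hsum hH r, Finset.sum_mul]
    refine Finset.sum_congr rfl fun j _ => ?_
    rw [mul_assoc, mul_assoc, hcomm _ (hsum.trace_mem_invariants H _)]
  -- Apply `β_g` to `∑ xᵢ yᵢ 1_a = 1_a`, multiply by `c` on the left, and use `c β_g(xᵢ 1_a) = xᵢ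
  -- c`.
  have hsplit : c = ∑ i, x i * c * B.app g (y i) := by
    have h1 := congrArg (B.app g) (hxy.sum_id a)
    simp only [B.app_sum, B.app_mul, B.app_app, Category.id_comp] at h1
    have h2 : B.app g (B.one a) = B.one b := by
      rw [← B.app_one (𝟙 a), B.app_app, B.app_one]
    rw [h2] at h1
    conv_lhs => rw [← B.mul_one b c hc.1, ← h1, Finset.mul_sum]
    refine Finset.sum_congr rfl fun i _ => ?_
    rw [← mul_assoc, hc.2]
  have hexpand (i : Fin m) : x i * c * B.app g (y i) =
      ∑ j, x j * c * B.trace H (y j * x i) * B.app g (y i) := by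
    rw [hright, Finset.sum_mul]
  -- With `r = xᵢ` in `hright`, the sum over `i` for fixed `j` contains the factor `∑ᵢ t_H(yⱼ xᵢ)
  -- β_g(yᵢ 1_a)`, which is zero.
  refine hsplit.trans ((Finset.sum_congr rfl fun i _ => hexpand i).trans ?_)
  rw [Finset.sum_comm]
  refine Finset.sum_eq_zero fun j _ => ?_
  simp only [mul_assoc]
  rw [← Finset.mul_sum, ← Finset.mul_sum, hxy.sum_trace_mul_app hsum hH hg, mul_zero, mul_zero]

end IsGaloisCoordinates

end Galois

/-- The elements of `J_g` with `g` in `H` centralize `R^{β_H}`. -/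
theorem commute_of_mem_J {H : Subgroupoid X} {a b : X} {g : a ⟶ b} (hg : g ∈ H.arrows a b)
    {c : R} (hc : c ∈ B.J g) {s : R} (hs : s ∈ B.invariants H) : c * s = s * c := by
  rw [← hc.2 s, hs g hg, ← B.one_comm, ← mul_assoc, B.mul_one b c hc.1]

/-- A nonzero element of `J_g` with `g ∈ H` centralizes `R^{β_H}`, hence the smaller ring `R^{β_L}`,
which forces `g ∈ L`. -/
theorem IsGaloisExtension.S_subset_of_invariants_le [Fintype X] [∀ a b : X, Finite (a ⟶ b)]
    (hG : B.IsGaloisExtension) (hsum : B.IsDirectSum) {H L : Subgroupoid X} (hL : L.IsWide)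
    (h : B.invariants L ≤ B.invariants H) (a b : X) : B.S H a b ⊆ B.S L a b := by
  obtain ⟨m, x, y, hxy⟩ := hG
  rintro g ⟨hg, hJ⟩
  obtain ⟨c, hc, hc0⟩ := (Submodule.ne_bot_iff _).1 hJ
  exact ⟨IsGaloisCoordinates.mem_of_commute (x := x) (y := y) hxy hsum hL hc hc0
    fun s hs => commute_of_mem_J hg hc (h hs), hJ⟩

end UnitalGroupoidAction

theorem mainTheorem3 {X : Type u} [Groupoid.{v} X] [Fintype X] [∀ a b : X, Finite (a ⟶ b)]
    {K : Type w} [CommRing K] {R : Type z} [Ring R] [Algebra K R]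
    (B : UnitalGroupoidAction X K R)
    (hsum : B.IsDirectSum)
    (hGalois : B.IsGaloisExtension)
    (hsep : IsSeparableExtension B.centerInvariants B.invariantRing)
    (hbar : ∀ H : Subgroupoid X,
      (∃ (a b : X) (g : a ⟶ b), g ∈ H.arrows a b) → H.IsWide → B.bar H = {H}) :
    Function.Injective B.galoisMap := by
  rintro ⟨H, hH, hHw⟩ ⟨L, hL, hLw⟩ hHL
  replace hHL : B.invariants H = B.invariants L := hHL
  have hS : B.S L = B.S H := by
    funext a b
    exact (hGalois.S_subset_of_invariants_le hsum hHw hHL.le a b).antisymm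
      (hGalois.S_subset_of_invariants_le hsum hLw hHL.ge a b)
  have hmem : L ∈ B.bar H := ⟨hL, hS⟩
  rw [hbar H hH hHw] at hmem
  exact Subtype.ext (Set.mem_singleton_iff.1 hmem).symm
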